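/- Identify Lorentz--Minkowski space $\mathbb L^3$ (metric $dx^2+dy^2-dt^2$) with $\mathbb C\times\mathbb R$ by $(x,y,t)\mapsto(x+iy,t)$, and write $A(r,R)=\{z\in\mathbb C: r<|z|<R\}$. A *generalised maximal surface* on a domain $\Omega\subset\mathbb C$ is a smooth map $F=(h,w):\Omega\to\mathbb C\times\mathbb R$ with $h_{z\bar z}=0$, $w_{z\bar z}=0$, $h_z\overline{h_{\bar z}}-w_z^2=0$ on $\Omega$, and $|h_z|$ not identically equal to $|h_{\bar z}|$ on $\Omega$. Its *singular set* is $\{z\in\Omega: |h_z|=|h_{\bar z}|\}$. Let $\gamma=(\gamma_1+i\gamma_2,\gamma_3):S^1\to\mathbb L^3$ be a real-analytic closed curve that is null ($\langle\gamma',\gamma'\rangle=0$, where $'=d/d\theta$ and zeros of $\gamma'$ are allowed), and let $L=(L_1+iL_2,L_3):S^1\to\mathbb L^3$ be a real-analytic vector field that is null ($\langle L,L\rangle=0$, zeros allowed), with $\langle\gamma',L\rangle=0$ on $S^1$ and at least one of $\gamma'$, $L$ not identically zero. Consider the map $$g=\sqrt{\frac{L_1+iL_2}{L_1-iL_2}}\quad\text{where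 } L_1+iL_2\neq0,\qquad g=\sqrt{\frac{\gamma_1'+i\gamma_2'}{\gamma_1'-i\gamma_2'}}\quad\text{where }\gamma_1'+i\gamma_2'\ne0$$ on $S^1$. It is well defined: there are an annulus $A(r_0,R_0)$ with $0<r_0<1<R_0$ and a holomorphic function $g(z)$ on it whose square on $S^1$ is given by both formulas wherever they make sense. Let $g(z)$ be any such analytic extension, on any annulus $A(r_0,R_0)$ with $0<r_0<1<R_0$. If $|g(z)|$ is not identically $1$ on $A(r_0,R_0)$, then there are $0<r<1<R$ and a generalised maximal surface $F=(h,w):A(r,R)\to\mathbb L^3$ such that, for all $\theta$, 1. $F(e^{i\theta})=\gamma(e^{i\theta})$, 2. $\left.\dfrac{\partial F}{\partial\rho}\right|_{e^{i\theta}}=L(e^{i\theta})$ (with $z=\rho e^{i\theta}$), and the singular set of $F$ contains $\{|z|=1\}$. The surface $F$ is unique: every generalised maximal surface on an annulus $A(r',R')$ with $0<r'<1<R'$ that satisfies 1 and 2 agrees with $F$ on $A(r,R)\cap A(r',R')$. -/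

import Mathlib

open scoped ComplexConjugate ContDiff

noncomputable section

/-- Lorentz-Minkowski space `𝕃³`, identified with `ℂ × ℝ` through `(x, y, t) ↦ (x + i y, t)`. -/
abbrev LorentzSpace : Type := ℂ × ℝ

/-- The Lorentz inner product `⟨p, q⟩ = p₁ q₁ + p₂ q₂ - p₃ q₃` of signature `(+, +, -)`. -/
def lorentzInner (p q : LorentzSpace) : ℝ :=
  p.1.re * q.1.re + p.1.im * q.1.im - p.2 * q.2

/-- A vector is null if `⟨p, p⟩ = 0`; the zero vector is allowed. -/
def IsNull (p : LorentzSpace) : Prop := lorentzInner p p = 0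

/-- Real analyticity of a map on the unit circle, read in the angular coordinate. -/
def IsAnalyticOnCircle (f : Circle → LorentzSpace) : Prop :=
  ∀ θ : ℝ, AnalyticAt ℝ (fun t : ℝ => f (Circle.exp t)) θ

/-- The derivative `f'(θ)` of `θ ↦ f (e^{iθ})`. -/
def angularDeriv (f : Circle → LorentzSpace) (θ : ℝ) : LorentzSpace :=
  deriv (fun t : ℝ => f (Circle.exp t)) θ

/-- Singular Björling data for a closed curve. -/
structure IsSingularBjorlingData (γ L : Circle → LorentzSpace) : Prop where
  analytic_curve : IsAnalyticOnCircle γ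
  analytic_field : IsAnalyticOnCircle L
  null_curve : ∀ θ : ℝ, IsNull (angularDeriv γ θ)
  null_field : ∀ p : Circle, IsNull (L p)
  orthogonal : ∀ θ : ℝ, lorentzInner (angularDeriv γ θ) (L (Circle.exp θ)) = 0
  nontrivial : (∃ θ : ℝ, angularDeriv γ θ ≠ 0) ∨ (∃ p : Circle, L p ≠ 0)

/-- The open annulus `A(r, R)` centred at the origin. -/
def annulus (r R : ℝ) : Set ℂ := {z | r < ‖z‖ ∧ ‖z‖ < R}

/-- The Wirtinger derivative `f_z = (f_x - i f_y) / 2`. -/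
def wirtinger (f : ℂ → ℂ) (z : ℂ) : ℂ :=
  (fderiv ℝ f z 1 - Complex.I * fderiv ℝ f z Complex.I) / 2

/-- The conjugate Wirtinger derivative `f_{z̄} = (f_x + i f_y) / 2`. -/
def wirtingerBar (f : ℂ → ℂ) (z : ℂ) : ℂ :=
  (fderiv ℝ f z 1 + Complex.I * fderiv ℝ f z Complex.I) / 2

/-- The complex coordinate `h` of `F = (h, w)`. -/
def hCoord (F : ℂ → LorentzSpace) (z : ℂ) : ℂ := (F z).1

/-- The real coordinate `w` of `F = (h, w)`, regarded as a complex-valued function. -/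
def wCoord (F : ℂ → LorentzSpace) (z : ℂ) : ℂ := ((F z).2 : ℂ)

/-- `F = (h, w) : Ω → ℂ × ℝ` is a generalised maximal surface: a smooth harmonic map on a domain,
conformal, with `|h_z|` not identically equal to `|h_{z̄}|`. -/
structure IsGeneralisedMaximalSurface (F : ℂ → LorentzSpace) (Ω : Set ℂ) : Prop where
  isOpen : IsOpen Ω
  isConnected : IsConnected Ω
  smooth : ContDiffOn ℝ ∞ F Ω
  harmonic_h : ∀ z ∈ Ω, wirtingerBar (wirtinger (hCoord F)) z = 0
  harmonic_w : ∀ z ∈ Ω, wirtingerBar (wirtinger (wCoord F)) z = 0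
  conformal : ∀ z ∈ Ω,
    wirtinger (hCoord F) z * conj (wirtingerBar (hCoord F) z) - wirtinger (wCoord F) z ^ 2 = 0
  nondegenerate : ∃ z ∈ Ω, ‖wirtinger (hCoord F) z‖ ≠ ‖wirtingerBar (hCoord F) z‖

/-- The singular set of `(F, Ω)`: the points of `Ω` where `|h_z| = |h_{z̄}|`. -/
def singularSet (F : ℂ → LorentzSpace) (Ω : Set ℂ) : Set ℂ :=
  {z ∈ Ω | ‖wirtinger (hCoord F) z‖ = ‖wirtingerBar (hCoord F) z‖}

/-- `G` is an analytic extension to the annulus `A(r, R)`, `0 < r < 1 < R`, of the map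
`g = √((L₁ + i L₂) / (L₁ - i L₂)) = √((γ₁' + i γ₂') / (γ₁' - i γ₂'))` on the unit circle.
The first formula is used where `L₁ + i L₂ ≠ 0` and the second one where `γ₁' + i γ₂' ≠ 0`;
if `γ'` or `L` vanishes identically, only the other one is left. At the remaining points, which
are isolated, `g` is determined by continuity. The square root is a branch that is analytic along
the whole circle. -/
structure IsGaussExtension (γ L : Circle → LorentzSpace) (r R : ℝ) (G : ℂ → ℂ) : Prop where
  pos : 0 < r
  lt_one : r < 1
  one_lt : 1 < R
  holomorphic : DifferentiableOn ℂ G (annulus r R)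
  sq_field : ∀ θ : ℝ, (L (Circle.exp θ)).1 ≠ 0 →
    G (Circle.exp θ) ^ 2 = (L (Circle.exp θ)).1 / conj (L (Circle.exp θ)).1
  sq_curve : ∀ θ : ℝ, (angularDeriv γ θ).1 ≠ 0 →
    G (Circle.exp θ) ^ 2 = (angularDeriv γ θ).1 / conj (angularDeriv γ θ).1

/-- `F` is a generalised maximal surface on the annulus `A(r, R)`, `0 < r < 1 < R`, with
`F = γ` and `∂F/∂ρ = L` on the unit circle. -/
structure SolvesSingularBjorling (γ L : Circle → LorentzSpace) (r R : ℝ)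
    (F : ℂ → LorentzSpace) : Prop where
  pos : 0 < r
  lt_one : r < 1
  one_lt : 1 < R
  surface : IsGeneralisedMaximalSurface F (annulus r R)
  eq_curve : ∀ p : Circle, F p = γ p
  radial_deriv : ∀ p : Circle, HasDerivAt (fun ρ : ℝ => F ((ρ : ℂ) * p)) (L p) 1

end

namespace SingularBjorling
open Filter Topology Metric Complex

/-! Prescribing `F` and its radial derivative on the circle is a Cauchy problem for harmonic
functions with analytic data. It is solved explicitly in `exists_harmonic_extension`, as a
holomorphic plus an antiholomorphic function plus a multiple of `log |z|`, the last term carrying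
the mean of the radial data.

For harmonic `h` and real harmonic `w` the functions `a = h_z`, `b = conj h_{z̄}` and `s = w_z` are
holomorphic. With `c = γ₁' + iγ₂'` and `l = L₁ + iL₂`, the Cauchy data give, on the circle, `z a =
(l - i c)/2`, `z b = (conj l - i conj c)/2` and `z s = (L₃ - iγ₃')/2`. Nullity and orthogonality are
exactly what makes `a b - s²` vanish there, so conformality propagates by the identity theorem. Two
orthogonal null vectors are parallel (`null_pair_identities`), so `c * conj l` is real, which gives
`|a| = |b|` on the circle: every circle point is singular.

Nondegeneracy is where `G` enters (`exists_norm_ne`). If `|a| = |b|` everywhere, then `b / a` is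
locally a unimodular constant. But `G² b = a` on the circle, so `G²` would be a unimodular constant,
contrary to `|G| ≢ 1`.

The root `g` is single-valued because it is the quotient of `c + i l` by `γ₃' + i L₃`, which have
equal modulus on the circle. Uniqueness is that of the Cauchy problem (`eqOn_zero_of_cauchy_data`)
and needs only harmonicity. -/

/-! ### Annuli around the unit circle and the identity theorem -/

theorem isOpen_annulus (r R : ℝ) : IsOpen (annulus r R) :=
  (isOpen_lt continuous_const continuous_norm).inter (isOpen_lt continuous_norm continuous_const)

theorem ne_zero_of_mem_annulus {r R : ℝ} (hr : 0 < r) {z : ℂ} (hz : z ∈ annulus r R) : z ≠ 0 :=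
  norm_pos_iff.1 (hr.trans hz.1)

theorem annulus_eq_image_exp {r R : ℝ} (hr : 0 < r) (hR : 0 < R) :
    annulus r R = Complex.exp '' (Complex.re ⁻¹' Set.Ioo (Real.log r) (Real.log R)) := by
  ext z
  constructor
  · intro hz
    have h0 := ne_zero_of_mem_annulus hr hz
    refine ⟨Complex.log z, ?_, Complex.exp_log h0⟩
    rw [Set.mem_preimage, Complex.log_re]
    exact ⟨Real.log_lt_log hr hz.1, Real.log_lt_log (norm_pos_iff.2 h0) hz.2⟩
  · rintro ⟨w, hw, rfl⟩
    refine ⟨?_, ?_⟩ <;> rw [Complex.norm_exp]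
    · exact (Real.log_lt_iff_lt_exp hr).1 hw.1
    · exact (Real.lt_log_iff_exp_lt hR).1 hw.2

theorem isPreconnected_annulus {r R : ℝ} (hr : 0 < r) (hR : 0 < R) :
    IsPreconnected (annulus r R) := by
  rw [annulus_eq_image_exp hr hR]
  exact (((convex_Ioo _ _).is_linear_preimage
    Complex.reLm.isLinear).isPreconnected).image _ Complex.continuous_exp.continuousOn

theorem circle_mem_annulus {r R : ℝ} (hr : r < 1) (hR : 1 < R) (p : Circle) :
    (p : ℂ) ∈ annulus r R :=
  ⟨by rwa [Circle.norm_coe], by rwa [Circle.norm_coe]⟩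

theorem annulus_inter (r R r' R' : ℝ) :
    annulus r R ∩ annulus r' R' = annulus (max r r') (min R R') := by
  ext z
  simp only [annulus, Set.mem_inter_iff, Set.mem_ofPred_eq, max_lt_iff, lt_min_iff]
  tauto

theorem annulus_mono {r R r' R' : ℝ} (hr : r ≤ r') (hR : R' ≤ R) :
    annulus r' R' ⊆ annulus r R :=
  fun _ hz => ⟨hr.trans_lt hz.1, hz.2.trans_le hR⟩

theorem hasDerivAt_circleExp (θ : ℝ) :
    HasDerivAt (fun t : ℝ => (Circle.exp t : ℂ)) (I * Circle.exp θ) θ := by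
  have h : HasDerivAt (fun z : ℂ => Complex.exp (z * I)) (Complex.exp (θ * I) * I) (θ : ℂ) := by
    simpa using ((hasDerivAt_id (θ : ℂ)).mul_const I).cexp
  simpa [Circle.coe_exp, mul_comm] using h.comp_ofReal

theorem tendsto_circleExp (θ : ℝ) :
    Tendsto (fun t : ℝ => (Circle.exp t : ℂ)) (𝓝[≠] θ) (𝓝[≠] (Circle.exp θ : ℂ)) :=
  (hasDerivAt_circleExp θ).tendsto_nhdsNE (mul_ne_zero I_ne_zero (Circle.coe_ne_zero _))

/-- The circle has no isolated points, so information along it alone is enough to feed the identity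
theorem. -/
theorem frequently_nhdsNE_circle {P : ℂ → Prop} {p : Circle}
    (h : ∀ᶠ q : ℂ in 𝓝[≠] (p : ℂ), ‖q‖ = 1 → P q) : ∃ᶠ q in 𝓝[≠] (p : ℂ), P q := by
  rw [← Circle.exp_arg p] at h ⊢
  refine (tendsto_circleExp _).frequently (Eventually.frequently ?_)
  exact ((tendsto_circleExp _).eventually h).mono fun t ht => ht (by simp)

/-- A holomorphic function on an annulus is determined by its values on the unit circle. -/
theorem eqOn_annulus {r R : ℝ} (hr : 0 < r) (hr1 : r < 1) (hR : 1 < R) {f g : ℂ → ℂ}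
    (hf : DifferentiableOn ℂ f (annulus r R)) (hg : DifferentiableOn ℂ g (annulus r R))
    (p : Circle) (h : ∀ᶠ q in 𝓝 (p : ℂ), ‖q‖ = 1 → f q = g q) : Set.EqOn f g (annulus r R) :=
  (hf.analyticOnNhd (isOpen_annulus r R)).eqOn_of_preconnected_of_frequently_eq
    (hg.analyticOnNhd (isOpen_annulus r R)) (isPreconnected_annulus hr (by linarith))
    (circle_mem_annulus hr1 hR p) (frequently_nhdsNE_circle (h.filter_mono nhdsWithin_le_nhds))

theorem exists_circle_eq {z : ℂ} (hz : ‖z‖ = 1) : ∃ p : Circle, (p : ℂ) = z :=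
  ⟨⟨z, mem_sphere_zero_iff_norm.2 hz⟩, rfl⟩

theorem eqOn_annulus_of_eq_circle {r R : ℝ} (hr : 0 < r) (hr1 : r < 1) (hR : 1 < R) {f g : ℂ → ℂ}
    (hf : DifferentiableOn ℂ f (annulus r R)) (hg : DifferentiableOn ℂ g (annulus r R))
    (h : ∀ p : Circle, f p = g p) : Set.EqOn f g (annulus r R) :=
  eqOn_annulus hr hr1 hR hf hg 1 (Eventually.of_forall fun q hq => by
    obtain ⟨q, rfl⟩ := exists_circle_eq hq
    exact h q)

/-! ### Holomorphic extension of analytic functions on the circle -/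

/-- A real-analytic function of a real variable extends locally to a holomorphic function. -/
theorem exists_analyticAt_complex {f : ℝ → ℂ} {t₀ : ℝ} (hf : AnalyticAt ℝ f t₀) :
    ∃ g : ℂ → ℂ, AnalyticAt ℂ g t₀ ∧ ∀ᶠ t in 𝓝 t₀, g (t : ℝ) = f t := by
  obtain ⟨p, r, hp⟩ := hf
  -- The same coefficients read over `ℂ`: the norms, hence the radius of convergence, do not change.
  let q : FormalMultilinearSeries ℂ ℂ ℂ := fun n =>
    ContinuousMultilinearMap.mkPiRing ℂ (Fin n) (p.coeff n)
  have hqn : ∀ n, ‖q n‖ = ‖p n‖ := fun n => by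
    rw [ContinuousMultilinearMap.norm_mkPiRing, FormalMultilinearSeries.norm_apply_eq_norm_coef]
  have hrad : q.radius = p.radius := by
    simp only [FormalMultilinearSeries.radius, hqn]
  have hpos : 0 < q.radius := hrad ▸ hp.r_pos.trans_le hp.r_le
  have hq := q.hasFPowerSeriesOnBall hpos
  have hq' : HasFPowerSeriesOnBall (fun z => q.sum (z - t₀)) q (t₀ : ℂ) q.radius := by
    simpa using hq.comp_sub (t₀ : ℂ)
  refine ⟨fun z => q.sum (z - t₀), hq'.analyticAt, ?_⟩
  filter_upwards [Metric.eball_mem_nhds t₀ hp.r_pos] with t ht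
  have h1 := hp.hasSum_sub ht
  rw [FormalMultilinearSeries.sum, ← h1.tsum_eq]
  refine tsum_congr fun n => ?_
  rw [FormalMultilinearSeries.apply_eq_pow_smul_coeff]
  have h2 : q.coeff n = p.coeff n := by
    rw [FormalMultilinearSeries.coeff]
    simp only [q, ContinuousMultilinearMap.mkPiRing_apply]
    simp
  rw [FormalMultilinearSeries.apply_eq_pow_smul_coeff, h2]
  simp

/-- The angular coordinate near a point of the circle is holomorphic. -/
theorem exists_local_angle (θ : ℝ) : ∃ T : ℂ → ℂ, AnalyticAt ℂ T (Circle.exp θ) ∧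
    T (Circle.exp θ) = θ ∧ ∀ᶠ q : ℂ in 𝓝 (Circle.exp θ : ℂ), ‖q‖ = 1 →
      ∃ t : ℝ, T q = t ∧ q = Circle.exp t := by
  have hp : (Circle.exp θ : ℂ) ≠ 0 := Circle.coe_ne_zero _
  -- Dividing by the base point moves it to `1`, away from the branch cut. On the circle `log`
  -- equals `i arg`, so the value is real.
  refine ⟨fun q => θ - I * Complex.log (q / Circle.exp θ), ?_, by simp, ?_⟩
  · refine analyticAt_const.sub (analyticAt_const.mul (AnalyticAt.clog ?_ ?_))
    · exact analyticAt_id.div analyticAt_const hp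
    · simp
  · refine Eventually.of_forall fun q hq => ⟨θ + arg (q / Circle.exp θ), ?_, ?_⟩
    · have h1 : Complex.log (q / Circle.exp θ) = arg (q / Circle.exp θ) * I := by
        rw [Complex.log, norm_div, hq]; simp
      show (θ : ℂ) - I * Complex.log (q / Circle.exp θ) = _
      rw [h1, ofReal_add]
      linear_combination (-(arg (q / Circle.exp θ) : ℂ)) * I_mul_I
    · rw [Circle.exp_add, Circle.coe_mul, Circle.coe_exp (arg _)]
      have h2 := norm_mul_exp_arg_mul_I (q / Circle.exp θ)
      rw [norm_div, hq, Circle.norm_coe, div_one, ofReal_one, one_mul] at h2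
      rw [h2, mul_div_cancel₀ _ hp]

/-- `f` agrees near every point of the circle with a holomorphic function. -/
def HasLocalExtension (f : Circle → ℂ) : Prop :=
  ∀ p : Circle, ∃ φ : ℂ → ℂ, AnalyticAt ℂ φ p ∧ ∀ᶠ q : ℂ in 𝓝 (p : ℂ), ∀ p' : Circle,
    (p' : ℂ) = q → φ q = f p'

theorem hasLocalExtension_of_analytic {f : Circle → ℂ}
    (hf : ∀ θ : ℝ, AnalyticAt ℝ (fun t : ℝ => f (Circle.exp t)) θ) : HasLocalExtension f := by
  intro p
  obtain ⟨θ, rfl⟩ := Circle.exp_surjective p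
  obtain ⟨g, hg, hgf⟩ := exists_analyticAt_complex (hf θ)
  obtain ⟨T, hT, hTθ, hTq⟩ := exists_local_angle θ
  refine ⟨g ∘ T, AnalyticAt.comp (by rwa [hTθ]) hT, ?_⟩
  have hcont : Tendsto T (𝓝 (Circle.exp θ : ℂ)) (𝓝 (θ : ℂ)) := hTθ ▸ hT.continuousAt.tendsto
  have hre : Tendsto (fun q => (T q).re) (𝓝 (Circle.exp θ : ℂ)) (𝓝 θ) := (Complex.continuous_re.tendsto _).comp hcont
  filter_upwards [hTq, hre.eventually hgf] with q hq1 hq2 p' hp'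
  obtain ⟨t, ht, hqt⟩ := hq1 (hp' ▸ Circle.norm_coe p')
  have : p' = Circle.exp t := Subtype.ext (hp'.trans hqt)
  rw [ht, ofReal_re] at hq2
  rw [Function.comp, ht, hq2, this]

/-- Local holomorphic extensions from the circle glue to an extension to an annulus. -/
theorem HasLocalExtension.exists_extension {f : Circle → ℂ} (hf : HasLocalExtension f) :
    ∃ δ : ℝ, 0 < δ ∧ δ < 1 ∧ ∃ φ : ℂ → ℂ, DifferentiableOn ℂ φ (annulus (1 - δ) (1 + δ)) ∧
      ∀ p : Circle, φ p = f p := by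
  have hball : ∀ p : Circle, ∃ ε > 0, ∃ φ : ℂ → ℂ, DifferentiableOn ℂ φ (ball (p : ℂ) ε) ∧
      ∀ p' : Circle, (p' : ℂ) ∈ ball (p : ℂ) ε → φ p' = f p' := by
    intro p
    obtain ⟨φ, hφ, hφf⟩ := hf p
    obtain ⟨ε, hε, h⟩ := Metric.eventually_nhds_iff_ball.1 (hφ.eventually_analyticAt.and hφf)
    exact ⟨ε, hε, φ, fun z hz => (h z hz).1.differentiableAt.differentiableWithinAt,
      fun p' hp' => (h p' hp').2 p' rfl⟩
  choose ε hε φ hφ hφf using hball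
  -- Compactness of the circle gives one radius that serves all its points.
  obtain ⟨δ, hδ, hδs⟩ := lebesgue_number_lemma_of_metric (s := sphere (0 : ℂ) 1)
    (c := fun p : Circle => ball (p : ℂ) (ε p)) (isCompact_sphere _ _) (fun _ => isOpen_ball)
    (fun z hz => Set.mem_iUnion.2 ⟨⟨z, by simpa [Submonoid.unitSphere] using hz⟩,
      mem_ball_self (hε _)⟩)
  have hδ' : ∀ p : Circle, ∃ ψ : ℂ → ℂ, DifferentiableOn ℂ ψ (ball (p : ℂ) δ) ∧
      ∀ p' : Circle, (p' : ℂ) ∈ ball (p : ℂ) δ → ψ p' = f p' := by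
    intro p
    obtain ⟨i, hi⟩ := hδs p (mem_sphere_zero_iff_norm.2 p.norm_coe)
    exact ⟨φ i, (hφ i).mono hi, fun p' hp' => hφf i p' (hi hp')⟩
  choose ψ hψ hψf using hδ'
  -- The bound `1 / 2` keeps the annulus away from `0`, where the radial projection `dir` is not
  -- continuous.
  set η := min δ (1 / 2) with hη
  have hη0 : 0 < η := by positivity
  have hη1 : η < 1 := (min_le_right _ _).trans_lt (by norm_num)
  have hηδ : η ≤ δ := min_le_left _ _
  let dir : ℂ → Circle := fun z => Circle.exp (arg z)
  have hdir : ∀ z : ℂ, z = ‖z‖ * dir z := fun z => by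
    simp [dir, Circle.coe_exp, norm_mul_exp_arg_mul_I]
  have hdirn : ∀ z : ℂ, dist z (dir z) = |‖z‖ - 1| := fun z => by
    rw [dist_eq_norm]
    nth_rewrite 1 [hdir z]
    rw [← sub_one_mul, norm_mul, Circle.norm_coe, mul_one, ← ofReal_one, ← ofReal_sub,
      norm_real, Real.norm_eq_abs]
  have hmem : ∀ z ∈ annulus (1 - η) (1 + η), z ∈ ball (dir z : ℂ) δ := fun z hz => by
    rw [mem_ball, hdirn]
    exact (abs_sub_lt_iff.2 ⟨by linarith [hz.2], by linarith [hz.1]⟩).trans_le hηδ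
  have hdirc : ∀ z : ℂ, z ≠ 0 → (dir z : ℂ) = z / ‖z‖ := fun z hz => by
    have : (‖z‖ : ℂ) ≠ 0 := by simpa using hz
    rw [eq_div_iff this, mul_comm, ← hdir]
  -- The value at `z` is taken from the local extension centred at the radial projection of `z`.
  refine ⟨η, hη0, hη1, fun z => ψ (dir z) z, fun z₀ hz₀ => ?_, fun p => ?_⟩
  · have h0 : z₀ ≠ 0 := ne_zero_of_mem_annulus (by linarith) hz₀
    have hnear : ∀ᶠ z in 𝓝 z₀, (dir z₀ : ℂ) ∈ ball (dir z : ℂ) δ := by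
      have hc : ContinuousAt (fun z : ℂ => z / (‖z‖ : ℂ)) z₀ := by
        refine continuousAt_id.div ?_ (by simpa using h0)
        exact (continuous_ofReal.comp continuous_norm).continuousAt
      have := hc.eventually (ball_mem_nhds (z₀ / ‖z₀‖ : ℂ) hδ)
      filter_upwards [this, isOpen_ne.mem_nhds h0] with z hz hz0
      rw [hdirc z₀ h0, hdirc z hz0, mem_ball_comm]
      exact hz
    have hd := (hψ (dir z₀)).differentiableAt (isOpen_ball.mem_nhds (hmem z₀ hz₀))
    refine (hd.congr_of_eventuallyEq ?_).differentiableWithinAt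
    filter_upwards [hnear, isOpen_ball.mem_nhds (hmem z₀ hz₀),
      (isOpen_annulus _ _).mem_nhds hz₀] with z hz1 hz2 hz3
    -- Two neighbouring extensions agree on the overlap of their balls: it is convex and contains
    -- the circle point `dir z₀`, near which both equal `f` on the circle.
    have hpre : IsPreconnected (ball (dir z : ℂ) δ ∩ ball (dir z₀ : ℂ) δ) :=
      ((convex_ball _ _).inter (convex_ball _ _)).isPreconnected
    have hopen : IsOpen (ball (dir z : ℂ) δ ∩ ball (dir z₀ : ℂ) δ) := isOpen_ball.inter isOpen_ball
    have hin : (dir z₀ : ℂ) ∈ ball (dir z : ℂ) δ ∩ ball (dir z₀ : ℂ) δ :=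
      ⟨hz1, mem_ball_self hδ⟩
    refine (((hψ (dir z)).mono Set.inter_subset_left).analyticOnNhd
      hopen).eqOn_of_preconnected_of_frequently_eq (((hψ (dir z₀)).mono
      Set.inter_subset_right).analyticOnNhd hopen) hpre hin (frequently_nhdsNE_circle ?_)
      ⟨hmem z hz3, hz2⟩
    refine Eventually.filter_mono nhdsWithin_le_nhds ?_
    filter_upwards [hopen.mem_nhds hin] with q hq hq1
    obtain ⟨q, rfl⟩ := exists_circle_eq hq1
    rw [hψf _ q hq.1, hψf _ q hq.2]
  · have : dir p = p := Circle.exp_arg p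
    simp only [this]
    exact hψf p p (mem_ball_self hδ)

/-! ### Wirtinger calculus -/

/-- The real-linear map `v ↦ a v + conj (b v)`, i.e. the differential of a function with Wirtinger
derivatives `a` and `conj b`. -/
noncomputable def wirtingerCLM (a b : ℂ) : ℂ →L[ℝ] ℂ :=
  a • ContinuousLinearMap.id ℝ ℂ +
    (conjCLE : ℂ →L[ℝ] ℂ).comp (b • ContinuousLinearMap.id ℝ ℂ)

@[simp] theorem wirtingerCLM_apply (a b v : ℂ) : wirtingerCLM a b v = a * v + conj (b * v) := by
  simp [wirtingerCLM]

theorem wirtinger_eq {h : ℂ → ℂ} {a b z : ℂ} (hh : HasFDerivAt h (wirtingerCLM a b) z) :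
    wirtinger h z = a := by
  rw [wirtinger, hh.fderiv]
  simp only [wirtingerCLM_apply, map_mul, conj_I, mul_one]
  linear_combination (-a / 2 + conj b / 2) * I_mul_I

theorem wirtingerBar_eq {h : ℂ → ℂ} {a b z : ℂ} (hh : HasFDerivAt h (wirtingerCLM a b) z) :
    wirtingerBar h z = conj b := by
  rw [wirtingerBar, hh.fderiv]
  simp only [wirtingerCLM_apply, map_mul, conj_I, mul_one]
  linear_combination (a / 2 - conj b / 2) * I_mul_I

theorem hasFDerivAt_add_conj {A B : ℂ → ℂ} {a b z : ℂ} (hA : HasDerivAt A a z)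
    (hB : HasDerivAt B b z) : HasFDerivAt (fun z => A z + conj (B z)) (wirtingerCLM a b) z := by
  have h := hA.hasFDerivAt.restrictScalars ℝ |>.add
    ((conjCLE : ℂ →L[ℝ] ℂ).hasFDerivAt.comp z (hB.hasFDerivAt.restrictScalars ℝ))
  refine h.congr_fderiv (ContinuousLinearMap.ext fun v => ?_)
  simp [mul_comm]

theorem wirtingerBar_of_hasDerivAt {f : ℂ → ℂ} {f' z : ℂ} (hf : HasDerivAt f f' z) :
    wirtingerBar f z = 0 := by
  have h := hasFDerivAt_add_conj hf (hasDerivAt_const z (0 : ℂ))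
  simp only [map_zero, add_zero] at h
  simpa using wirtingerBar_eq h

/-- For unimodular `c`, `log |z|` is the real part of `log (c z)`. One of `c = 1` and `c = -1`
avoids the branch cut. -/
theorem hasFDerivAt_log_norm {z : ℂ} (hz : z ≠ 0) :
    HasFDerivAt (fun z : ℂ => (Real.log ‖z‖ : ℂ)) (wirtingerCLM (1 / (2 * z)) (1 / (2 * z))) z := by
  have key : ∀ c : ℂ, ‖c‖ = 1 → c * z ∈ slitPlane →
      HasFDerivAt (fun z : ℂ => (Real.log ‖z‖ : ℂ))
        (wirtingerCLM (1 / (2 * z)) (1 / (2 * z))) z := by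
    intro c hc hcz
    have hc0 : c ≠ 0 := by rw [← norm_ne_zero_iff, hc]; exact one_ne_zero
    have h1 : HasDerivAt (fun z : ℂ => Complex.log (c * z) / 2) (1 / (2 * z)) z := by
      refine ((((hasDerivAt_id z).const_mul c).clog hcz).div_const 2).congr_deriv ?_
      simp only [id]
      field_simp
    refine (hasFDerivAt_add_conj h1 h1).congr_of_eventuallyEq (Eventually.of_forall fun w => ?_)
    have h2 : ((Complex.log (c * w)).re : ℂ) = Real.log ‖w‖ := by
      rw [Complex.log_re, norm_mul, hc, one_mul]
    show (Real.log ‖w‖ : ℂ) = _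
    simp only [← h2, re_eq_add_conj, map_div₀, conj_ofNat]
    ring
  by_cases h : z ∈ slitPlane
  · exact key 1 (by simp) (by simpa using h)
  · refine key (-1) (by simp) ?_
    rw [mem_slitPlane_iff, not_or, not_lt, not_not] at h
    rw [neg_one_mul, mem_slitPlane_iff, neg_re, neg_im]
    exact Or.inl (neg_pos.2 (h.1.lt_of_ne fun hre => hz (Complex.ext hre h.2)))

theorem hasDerivAt_tangential {h : ℂ → ℂ} {a b : ℂ} {θ : ℝ}
    (hh : HasFDerivAt h (wirtingerCLM a b) (Circle.exp θ)) :
    HasDerivAt (fun t : ℝ => h (Circle.exp t))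
      (I * (a * Circle.exp θ - conj (b * Circle.exp θ))) θ := by
  refine (hh.comp_hasDerivAt θ (hasDerivAt_circleExp θ)).congr_deriv ?_
  simp only [wirtingerCLM_apply, map_mul, conj_I]
  ring

theorem hasDerivAt_radial {h : ℂ → ℂ} {a b : ℂ} {p : Circle}
    (hh : HasFDerivAt h (wirtingerCLM a b) p) :
    HasDerivAt (fun ρ : ℝ => h ((ρ : ℂ) * p)) (a * p + conj (b * p)) 1 := by
  have h1 : HasDerivAt (fun ρ : ℝ => (ρ : ℂ) * p) (p : ℂ) 1 := by
    simpa using ((hasDerivAt_id (1 : ℝ)).ofReal_comp).mul_const (p : ℂ)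
  have h2 : HasFDerivAt h (wirtingerCLM a b) ((fun ρ : ℝ => (ρ : ℂ) * p) 1) := by simpa using hh
  exact (h2.comp_hasDerivAt (1 : ℝ) h1).congr_deriv (wirtingerCLM_apply _ _ _)

theorem hasDerivAt_comp_circleExp {φ : ℂ → ℂ} {θ : ℝ}
    (hφ : DifferentiableAt ℂ φ (Circle.exp θ)) :
    HasDerivAt (fun t : ℝ => φ (Circle.exp t))
      (I * (deriv φ (Circle.exp θ) * Circle.exp θ)) θ :=
  (hφ.hasDerivAt.comp θ (hasDerivAt_circleExp θ)).congr_deriv (by ring)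

/-- The differential is assembled linearly from holomorphic functions, hence is itself smooth. -/
theorem contDiffOn_of_wirtinger {h a b : ℂ → ℂ} {U : Set ℂ} (hU : IsOpen U)
    (ha : DifferentiableOn ℂ a U) (hb : DifferentiableOn ℂ b U)
    (hh : ∀ z ∈ U, HasFDerivAt h (wirtingerCLM (a z) (b z)) z) : ContDiffOn ℝ ∞ h U := by
  rw [contDiffOn_infty_iff_fderiv_of_isOpen hU]
  refine ⟨fun z hz => (hh z hz).differentiableAt.differentiableWithinAt, ?_⟩
  have ha' : ContDiffOn ℝ ∞ a U := (ha.contDiffOn hU).restrict_scalars ℝ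
  have hb' : ContDiffOn ℝ ∞ b U := (hb.contDiffOn hU).restrict_scalars ℝ
  refine ContDiffOn.congr (f := fun z => wirtingerCLM (a z) (b z)) ?_ fun z hz => (hh z hz).fderiv
  exact (ha'.smul contDiffOn_const).add (contDiffOn_const.clm_comp (hb'.smul contDiffOn_const))

/-! ### The Cauchy problem for harmonic functions on the circle -/

/-- A primitive of a real-analytic function is real-analytic. -/
theorem analyticAt_of_hasDerivAt {N g : ℝ → ℂ} {t₀ : ℝ} (hN : ∀ t, HasDerivAt N (g t) t)
    (hg : AnalyticAt ℝ g t₀) : AnalyticAt ℝ N t₀ := by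
  obtain ⟨G, hG, hGg⟩ := exists_analyticAt_complex hg
  obtain ⟨ε, hε, hball⟩ := Metric.eventually_nhds_iff_ball.1 hG.eventually_analyticAt
  obtain ⟨Φ, hΦ⟩ := DifferentiableOn.isExactOn_ball (f := G) (c := t₀) (r := ε)
    fun z hz => (hball z hz).differentiableAt.differentiableWithinAt
  obtain ⟨η, hη, hη'⟩ := Metric.eventually_nhds_iff_ball.1 hGg
  have hΦa : AnalyticAt ℝ (fun t : ℝ => Φ t) t₀ := by
    have h1 : AnalyticAt ℂ Φ t₀ := DifferentiableOn.analyticAt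
      (fun z hz => (hΦ z hz).differentiableAt.differentiableWithinAt) (ball_mem_nhds _ hε)
    exact h1.restrictScalars.comp (ofRealCLM.analyticAt t₀)
  -- On this ball `N` and the holomorphic primitive `Φ` have the same derivative, so they differ by
  -- a constant.
  set r := min ε η
  have hr : 0 < r := lt_min hε hη
  have hd : ∀ t ∈ ball t₀ r, HasDerivAt (fun t : ℝ => N t - Φ t) 0 t := by
    intro t ht
    have ht1 : (t : ℂ) ∈ ball (t₀ : ℂ) ε := by
      rw [mem_ball, Complex.dist_eq, ← ofReal_sub, norm_real, Real.norm_eq_abs, ← Real.dist_eq]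
      exact ht.trans_le (min_le_left _ _)
    have h2 := (hN t).sub ((hΦ t ht1).comp_ofReal)
    rwa [hη' t (ball_subset_ball (min_le_right _ _) ht), sub_self] at h2
  have hconst : ∀ t ∈ ball t₀ r, N t - Φ t = N t₀ - Φ t₀ := fun t ht =>
    (convex_ball t₀ r).is_const_of_fderivWithin_eq_zero (𝕜 := ℝ)
      (fun s hs => (hd s hs).differentiableAt.differentiableWithinAt)
      (fun s hs => by
        rw [fderivWithin_of_isOpen isOpen_ball hs]
        ext; simpa using (hd s hs).deriv) ht (mem_ball_self hr)
  refine (hΦa.add (analyticAt_const (v := N t₀ - Φ t₀))).congr ?_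
  filter_upwards [ball_mem_nhds t₀ hr] with t ht
  show Φ t + (N t₀ - Φ t₀) = N t
  rw [← hconst t ht]; ring

/-- Up to a multiple of the angle, an analytic function on the circle has a primitive there. -/
theorem exists_circle_primitive {l : Circle → ℂ}
    (hl : ∀ θ : ℝ, AnalyticAt ℝ (fun t : ℝ => l (Circle.exp t)) θ) :
    ∃ (b₀ : ℂ) (M : Circle → ℂ), (∀ θ : ℝ, AnalyticAt ℝ (fun t : ℝ => M (Circle.exp t)) θ) ∧
      ∀ θ : ℝ, HasDerivAt (fun t : ℝ => M (Circle.exp t)) (I * (l (Circle.exp θ) - b₀)) θ := by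
  have hc : Continuous fun t : ℝ => l (Circle.exp t) :=
    continuous_iff_continuousAt.2 fun θ => (hl θ).continuousAt
  -- The mean of `l`: subtracting it is what makes the primitive periodic.
  set b₀ : ℂ := (∫ t in (0 : ℝ)..2 * Real.pi, l (Circle.exp t)) / (2 * Real.pi) with hb₀
  set g : ℝ → ℂ := fun t => I * (l (Circle.exp t) - b₀) with hg
  have hgc : Continuous g := continuous_const.mul (hc.sub continuous_const)
  set N : ℝ → ℂ := fun t => ∫ s in (0 : ℝ)..t, g s with hN
  have hNd : ∀ t, HasDerivAt N (g t) t := fun t =>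
    (hgc.integral_hasStrictDerivAt 0 t).hasDerivAt
  have hgper : Function.Periodic g (2 * Real.pi) := fun t => by
    simp only [hg, Circle.exp_add_two_pi]
  have hint : ∫ s in (0 : ℝ)..2 * Real.pi, g s = 0 := by
    have hpi : (2 * Real.pi : ℂ) ≠ 0 := by
      exact_mod_cast Real.two_pi_pos.ne'
    simp only [hg, intervalIntegral.integral_const_mul]
    rw [intervalIntegral.integral_sub (hc.intervalIntegrable _ _)
      (continuous_const.intervalIntegrable _ _), intervalIntegral.integral_const, hb₀]
    simp only [sub_zero, real_smul, ofReal_mul, ofReal_ofNat]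
    rw [mul_div_cancel₀ _ hpi, sub_self, mul_zero]
  have hNper : Function.Periodic N (2 * Real.pi) := fun t => by
    simp only [hN]
    rw [← intervalIntegral.integral_add_adjacent_intervals (hgc.intervalIntegrable 0 t)
      (hgc.intervalIntegrable t _), hgper.intervalIntegral_add_eq t 0, zero_add, hint, add_zero]
  -- Periodicity makes the primitive a function of the circle point, whatever choice of angle `arg`
  -- makes.
  have hM : ∀ t : ℝ, N (arg (Circle.exp t)) = N t := fun t => by
    obtain ⟨m, hm⟩ := Circle.exp_eq_exp.1 (Circle.exp_arg (Circle.exp t))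
    rw [hm]
    exact (hNper.int_mul m) t
  refine ⟨b₀, fun p => N (arg p), fun θ => ?_, fun θ => ?_⟩ <;> simp only [hM]
  · exact analyticAt_of_hasDerivAt hNd (analyticAt_const.mul ((hl θ).sub analyticAt_const))
  · exact hNd θ

theorem exists_extension_annulus {f : Circle → ℂ}
    (hf : ∀ θ : ℝ, AnalyticAt ℝ (fun t : ℝ => f (Circle.exp t)) θ) :
    ∃ R : ℝ, 1 < R ∧ ∃ φ : ℂ → ℂ, DifferentiableOn ℂ φ (annulus R⁻¹ R) ∧
      ∀ p : Circle, φ p = f p := by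
  obtain ⟨δ, h0, h1, φ, hφ, hφf⟩ := (hasLocalExtension_of_analytic hf).exists_extension
  refine ⟨1 + δ, by linarith, φ, hφ.mono (annulus_mono ?_ le_rfl), hφf⟩
  rw [← one_div, le_div_iff₀ (by linarith)]
  nlinarith

theorem annulus_inv_mono {R R' : ℝ} (hR : 1 < R) (h : R ≤ R') :
    annulus R⁻¹ R ⊆ annulus R'⁻¹ R' :=
  annulus_mono (inv_anti₀ (by linarith) h) h

/-- The reflection `z ↦ 1 / conj z` fixes the circle pointwise and preserves `A(R⁻¹, R)`.
Conjugating before and after makes the result holomorphic, with boundary values the conjugates of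
those of `φ`. -/
theorem differentiableOn_reflection {R : ℝ} (hR : 1 < R) {φ : ℂ → ℂ}
    (hφ : DifferentiableOn ℂ φ (annulus R⁻¹ R)) :
    DifferentiableOn ℂ (fun z => conj (φ (conj z)⁻¹)) (annulus R⁻¹ R) := by
  intro z hz
  have hR0 : 0 < R := by linarith
  have hz0 : z ≠ 0 := ne_zero_of_mem_annulus (inv_pos.2 hR0) hz
  have hmem : conj z⁻¹ ∈ annulus R⁻¹ R := by
    refine ⟨?_, ?_⟩ <;> rw [norm_conj, norm_inv]
    · exact inv_strictAnti₀ (norm_pos_iff.2 hz0) hz.2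
    · exact inv_lt_of_inv_lt₀ hR0 hz.1
  have h1 : DifferentiableAt ℂ (conj ∘ φ ∘ conj) z⁻¹ := by
    simpa using (hφ.differentiableAt ((isOpen_annulus _ _).mem_nhds hmem)).conj_conj
  have h2 := h1.comp z (differentiableAt_inv hz0)
  refine DifferentiableAt.differentiableWithinAt ?_
  simpa [Function.comp_def] using h2

/-- The Cauchy problem for harmonic functions with analytic data on the unit circle. -/
theorem exists_harmonic_extension {f l : Circle → ℂ}
    (hf : ∀ θ : ℝ, AnalyticAt ℝ (fun t : ℝ => f (Circle.exp t)) θ)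
    (hl : ∀ θ : ℝ, AnalyticAt ℝ (fun t : ℝ => l (Circle.exp t)) θ) :
    ∃ R : ℝ, 1 < R ∧ ∃ h a b : ℂ → ℂ, DifferentiableOn ℂ a (annulus R⁻¹ R) ∧
      DifferentiableOn ℂ b (annulus R⁻¹ R) ∧
      (∀ z ∈ annulus R⁻¹ R, HasFDerivAt h (wirtingerCLM (a z) (b z)) z) ∧
      (∀ p : Circle, h p = f p) ∧ ∀ p : Circle, a p * p + conj (b p * p) = l p := by
  obtain ⟨b₀, M, hMa, hMd⟩ := exists_circle_primitive hl
  obtain ⟨R₁, hR₁, C, hC, hCf⟩ := exists_extension_annulus hf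
  obtain ⟨R₂, hR₂, m, hm, hmM⟩ := exists_extension_annulus hMa
  set R := min R₁ R₂ with hRdef
  have hR : 1 < R := lt_min hR₁ hR₂
  have hR0 : 0 < R⁻¹ := by positivity
  replace hC := hC.mono (annulus_inv_mono hR (min_le_left _ _))
  replace hm := hm.mono (annulus_inv_mono hR (min_le_right _ _))
  have hopen := isOpen_annulus R⁻¹ R
  -- On the circle `A + conj B = C = f`. Reflection reverses the radial direction, so in the radial
  -- derivative the `C` terms cancel and the `m` terms add up to `z m' = l - b₀`; the term `b₀ log
  -- |z|` supplies the missing `b₀`.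
  set A : ℂ → ℂ := fun z => (C z + m z) / 2 with hA
  set B : ℂ → ℂ := fun z => (conj (C (conj z)⁻¹) - conj (m (conj z)⁻¹)) / 2 with hB
  have hAd : DifferentiableOn ℂ A (annulus R⁻¹ R) := (hC.add hm).div_const 2
  have hBd : DifferentiableOn ℂ B (annulus R⁻¹ R) :=
    ((differentiableOn_reflection hR hC).sub (differentiableOn_reflection hR hm)).div_const 2
  have hlogd : ∀ c : ℂ, DifferentiableOn ℂ (fun z => c / (2 * z)) (annulus R⁻¹ R) := fun c =>
    (differentiableOn_const c).div (differentiableOn_id.const_mul 2) fun z hz =>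
      mul_ne_zero two_ne_zero (ne_zero_of_mem_annulus hR0 hz)
  set h : ℂ → ℂ := fun z => (A z + conj (B z)) + b₀ * (Real.log ‖z‖ : ℂ) with hh
  have hpC : ∀ p : Circle, (p : ℂ) ∈ annulus R⁻¹ R := circle_mem_annulus (inv_lt_one_of_one_lt₀ hR) hR
  have hhd : ∀ z ∈ annulus R⁻¹ R, HasFDerivAt h (wirtingerCLM (deriv A z + b₀ / (2 * z))
      (deriv B z + conj b₀ / (2 * z))) z := by
    intro z hz
    have hz0 := ne_zero_of_mem_annulus hR0 hz
    have h1 := hasFDerivAt_add_conj (hAd.hasDerivAt (hopen.mem_nhds hz))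
      (hBd.hasDerivAt (hopen.mem_nhds hz))
    refine (h1.add ((hasFDerivAt_log_norm hz0).const_mul b₀)).congr_fderiv
      (ContinuousLinearMap.ext fun v => ?_)
    simp only [_root_.add_apply, _root_.smul_apply, wirtingerCLM_apply,
      smul_eq_mul, map_add, map_mul, map_div₀, conj_conj, map_one]
    ring
  have hhf : ∀ p : Circle, h p = f p := fun p => by
    have hinv : (conj (p : ℂ))⁻¹ = p := by
      rw [← Circle.coe_inv_eq_conj, Circle.coe_inv, inv_inv]
    simp only [hh, hA, hB, hinv, Circle.norm_coe, Real.log_one, ofReal_zero, mul_zero, add_zero,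
      map_div₀, map_sub, conj_conj, conj_ofNat, hCf]
    ring
  refine ⟨R, hR, h, _, _, (hAd.deriv hopen).add (hlogd b₀), (hBd.deriv hopen).add (hlogd (conj b₀)),
    hhd, hhf, fun p => ?_⟩
  obtain ⟨θ, rfl⟩ := Circle.exp_surjective p
  have e1 := hasDerivAt_tangential (hhd _ (hpC (Circle.exp θ)))
  have e2 := hasDerivAt_comp_circleExp (hC.differentiableAt (hopen.mem_nhds (hpC (Circle.exp θ))))
  have e3 := hasDerivAt_comp_circleExp (hm.differentiableAt (hopen.mem_nhds (hpC (Circle.exp θ))))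
  have e4 := hMd θ
  simp only [hhf] at e1
  simp only [hCf] at e2
  simp only [hmM] at e3
  have e5 := mul_left_cancel₀ I_ne_zero (e1.unique e2)
  have e6 := mul_left_cancel₀ I_ne_zero (e3.unique e4)
  have e7 : deriv A (Circle.exp θ) =
      (deriv C (Circle.exp θ) + deriv m (Circle.exp θ)) / 2 := by
    have hn := hopen.mem_nhds (hpC (Circle.exp θ))
    exact (((hC.hasDerivAt hn).add (hm.hasDerivAt hn)).div_const 2).deriv
  have e8 : b₀ / (2 * (Circle.exp θ : ℂ)) * Circle.exp θ = b₀ / 2 := by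
    field_simp [Circle.coe_ne_zero]
  simp only [Pi.add_apply] at e5 ⊢
  linear_combination -e5 + e6 + 2 * Circle.exp θ * e7 + 2 * e8

/-! ### Uniqueness -/

theorem hasFDerivAt_wirtingerCLM {f : ℂ → ℂ} {z : ℂ} (hf : DifferentiableAt ℝ f z) :
    HasFDerivAt f (wirtingerCLM (wirtinger f z) (conj (wirtingerBar f z))) z := by
  refine hf.hasFDerivAt.congr_fderiv (ContinuousLinearMap.ext fun v => ?_)
  have h1 : fderiv ℝ f z v = v.re * fderiv ℝ f z 1 + v.im * fderiv ℝ f z I := by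
    have hv : v = v.re • (1 : ℂ) + v.im • I := by
      simp [real_smul, re_add_im]
    conv_lhs => rw [hv]
    rw [map_add, map_smul, map_smul, real_smul, real_smul]
  have h2 : conj v = v.re - v.im * I := by
    apply Complex.ext <;> simp
  rw [h1, wirtingerCLM_apply, map_mul, conj_conj, h2, wirtinger, wirtingerBar]
  nth_rewrite 3 [← re_add_im v]
  linear_combination (v.im : ℂ) * fderiv ℝ f z I * I_mul_I

theorem HasFDerivAt.conj_wirtinger {f : ℂ → ℂ} {a b z : ℂ}
    (hf : HasFDerivAt f (wirtingerCLM a b) z) :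
    HasFDerivAt (fun z => conj (f z)) (wirtingerCLM b a) z := by
  refine ((conjCLE : ℂ →L[ℝ] ℂ).hasFDerivAt.comp z hf).congr_fderiv
    (ContinuousLinearMap.ext fun v => ?_)
  simp [add_comm]

theorem hasDerivAt_of_wirtinger {f : ℂ → ℂ} {a z : ℂ}
    (hf : HasFDerivAt f (wirtingerCLM a 0) z) : HasDerivAt f a z := by
  refine (hasFDerivAt_of_restrictScalars ℝ (f' := ContinuousLinearMap.toSpanSingleton ℂ a)
    hf (ContinuousLinearMap.ext fun v => ?_)).hasDerivAt.congr_deriv (by simp)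
  simp [mul_comm]

theorem contDiffOn_wirtinger {f : ℂ → ℂ} {U : Set ℂ} (hU : IsOpen U) (hf : ContDiffOn ℝ ∞ f U) :
    ContDiffOn ℝ ∞ (wirtinger f) U := by
  have h : ContDiffOn ℝ ∞ (fderiv ℝ f) U := hf.fderiv_of_isOpen hU (by simp)
  exact ((h.clm_apply contDiffOn_const).sub
    (contDiffOn_const.mul (h.clm_apply contDiffOn_const))).div_const 2

theorem differentiableOn_of_wirtingerBar_eq_zero {f : ℂ → ℂ} {U : Set ℂ}
    (hU : IsOpen U) (hf : ContDiffOn ℝ ∞ f U) (h : ∀ z ∈ U, wirtingerBar f z = 0) :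
    DifferentiableOn ℂ f U := by
  intro z hz
  have h1 := hasFDerivAt_wirtingerCLM
    ((hf.differentiableOn (by simp)).differentiableAt (hU.mem_nhds hz))
  rw [h z hz, map_zero] at h1
  exact (hasDerivAt_of_wirtinger h1).differentiableAt.differentiableWithinAt

/-- A harmonic function with vanishing Cauchy data on the unit circle vanishes. -/
theorem eqOn_zero_of_cauchy_data {r R : ℝ} (hr : 0 < r) (hr1 : r < 1) (hR : 1 < R) {D : ℂ → ℂ}
    (hD : ContDiffOn ℝ ∞ D (annulus r R))
    (hharm : ∀ z ∈ annulus r R, wirtingerBar (wirtinger D) z = 0) (h0 : ∀ p : Circle, D p = 0)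
    (h1 : ∀ p : Circle, HasDerivAt (fun ρ : ℝ => D ((ρ : ℂ) * p)) 0 1) :
    Set.EqOn D 0 (annulus r R) := by
  have hopen := isOpen_annulus r R
  have hd : ∀ z ∈ annulus r R, HasFDerivAt D
      (wirtingerCLM (wirtinger D z) (conj (wirtingerBar D z))) z := fun z hz =>
    hasFDerivAt_wirtingerCLM ((hD.differentiableOn (by simp)).differentiableAt (hopen.mem_nhds hz))
  have hhol := differentiableOn_of_wirtingerBar_eq_zero hopen (contDiffOn_wirtinger hopen hD) hharm
  -- The tangential and radial derivatives together span the differential, so `D_z` vanishes on the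
  -- circle.
  have hcirc : ∀ p : Circle, wirtinger D p = 0 := by
    intro p
    obtain ⟨θ, rfl⟩ := Circle.exp_surjective p
    have hp := hd _ (circle_mem_annulus hr1 hR (Circle.exp θ))
    have e1 := hasDerivAt_tangential hp
    simp only [h0] at e1
    have e2 := e1.unique (hasDerivAt_const θ (0 : ℂ))
    have e3 := (hasDerivAt_radial hp).unique (h1 _)
    have e4 := (mul_eq_zero.1 e2).resolve_left I_ne_zero
    have e5 : wirtinger D (Circle.exp θ) * Circle.exp θ = 0 := by
      linear_combination (e3 + e4) / 2
    exact (mul_eq_zero.1 e5).resolve_right (Circle.coe_ne_zero _)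
  have hz0 : Set.EqOn (wirtinger D) (fun _ => 0) (annulus r R) :=
    eqOn_annulus_of_eq_circle hr hr1 hR hhol (differentiableOn_const 0) hcirc
  -- Once `D_z = 0`, the conjugate of `D` is holomorphic and the identity theorem applies a second
  -- time.
  have hanti : DifferentiableOn ℂ (fun z => conj (D z)) (annulus r R) := fun z hz => by
    have h2 := hd z hz
    rw [hz0 hz] at h2
    exact (hasDerivAt_of_wirtinger
      (HasFDerivAt.conj_wirtinger h2)).differentiableAt.differentiableWithinAt
  have hfin := eqOn_annulus_of_eq_circle hr hr1 hR hanti (differentiableOn_const 0)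
    fun p => by simp [h0]
  exact fun z hz => by simpa using hfin hz

theorem wirtinger_sub_eventuallyEq {u v : ℂ → ℂ} {U : Set ℂ} (hU : IsOpen U)
    (hu : DifferentiableOn ℝ u U) (hv : DifferentiableOn ℝ v U) {z : ℂ} (hz : z ∈ U) :
    wirtinger (u - v) =ᶠ[𝓝 z] wirtinger u - wirtinger v := by
  filter_upwards [hU.mem_nhds hz] with w hw
  have h := hU.mem_nhds hw
  rw [wirtinger, fderiv_sub (hu.differentiableAt h) (hv.differentiableAt h)]
  simp only [Pi.sub_apply, _root_.sub_apply, wirtinger]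
  ring

theorem wirtingerBar_wirtinger_sub {u v : ℂ → ℂ} {U : Set ℂ} (hU : IsOpen U)
    (hu : ContDiffOn ℝ ∞ u U) (hv : ContDiffOn ℝ ∞ v U) {z : ℂ} (hz : z ∈ U) :
    wirtingerBar (wirtinger (u - v)) z =
      wirtingerBar (wirtinger u) z - wirtingerBar (wirtinger v) z := by
  have h := hU.mem_nhds hz
  have hu' := ((contDiffOn_wirtinger hU hu).differentiableOn (by simp)).differentiableAt h
  have hv' := ((contDiffOn_wirtinger hU hv).differentiableOn (by simp)).differentiableAt h
  rw [wirtingerBar, (wirtinger_sub_eventuallyEq hU (hu.differentiableOn (by simp))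
    (hv.differentiableOn (by simp)) hz).fderiv_eq, fderiv_sub hu' hv']
  simp only [_root_.sub_apply, wirtingerBar]
  ring

theorem contDiffOn_hCoord {F : ℂ → LorentzSpace} {U : Set ℂ} (hF : ContDiffOn ℝ ∞ F U) :
    ContDiffOn ℝ ∞ (hCoord F) U := contDiff_fst.comp_contDiffOn hF

theorem contDiffOn_wCoord {F : ℂ → LorentzSpace} {U : Set ℂ} (hF : ContDiffOn ℝ ∞ F U) :
    ContDiffOn ℝ ∞ (wCoord F) U :=
  ofRealCLM.contDiff.comp_contDiffOn (contDiff_snd.comp_contDiffOn hF)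

theorem hasDerivAt_fst {f : ℝ → LorentzSpace} {f' : LorentzSpace} {t : ℝ}
    (hf : HasDerivAt f f' t) : HasDerivAt (fun t => (f t).1) f'.1 t :=
  (ContinuousLinearMap.fst ℝ ℂ ℝ).hasFDerivAt.comp_hasDerivAt t hf

theorem hasDerivAt_snd {f : ℝ → LorentzSpace} {f' : LorentzSpace} {t : ℝ}
    (hf : HasDerivAt f f' t) : HasDerivAt (fun t => ((f t).2 : ℂ)) (f'.2 : ℂ) t :=
  ((ContinuousLinearMap.snd ℝ ℂ ℝ).hasFDerivAt.comp_hasDerivAt t hf).ofReal_comp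

/-- Two solutions of the same singular Björling problem agree where both are defined. -/
theorem eqOn_of_solvesSingularBjorling {γ L : Circle → LorentzSpace} {r R r' R' : ℝ}
    {F F' : ℂ → LorentzSpace} (hF : SolvesSingularBjorling γ L r R F)
    (hF' : SolvesSingularBjorling γ L r' R' F') :
    Set.EqOn F' F (annulus r R ∩ annulus r' R') := by
  rw [annulus_inter]
  have hr : 0 < max r r' := hF.pos.trans_le (le_max_left _ _)
  have hr1 : max r r' < 1 := max_lt hF.lt_one hF'.lt_one
  have hR : 1 < min R R' := lt_min hF.one_lt hF'.one_lt
  have hopen := isOpen_annulus (max r r') (min R R')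
  have hs : annulus (max r r') (min R R') ⊆ annulus r R :=
    annulus_mono (le_max_left _ _) (min_le_left _ _)
  have hs' : annulus (max r r') (min R R') ⊆ annulus r' R' :=
    annulus_mono (le_max_right _ _) (min_le_right _ _)
  have hc := hF.surface.smooth.mono hs
  have hc' := hF'.surface.smooth.mono hs'
  have h1 := eqOn_zero_of_cauchy_data hr hr1 hR (D := hCoord F' - hCoord F)
    ((contDiffOn_hCoord hc').sub (contDiffOn_hCoord hc))
    (fun z hz => by
      rw [wirtingerBar_wirtinger_sub hopen (contDiffOn_hCoord hc') (contDiffOn_hCoord hc) hz,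
        hF.surface.harmonic_h z (hs hz), hF'.surface.harmonic_h z (hs' hz), sub_zero])
    (fun p => by simp [hCoord, hF.eq_curve, hF'.eq_curve])
    (fun p =>
      ((hasDerivAt_fst (hF'.radial_deriv p)).sub
        (hasDerivAt_fst (hF.radial_deriv p))).congr_deriv (sub_self _))
  have h2 := eqOn_zero_of_cauchy_data hr hr1 hR (D := wCoord F' - wCoord F)
    ((contDiffOn_wCoord hc').sub (contDiffOn_wCoord hc))
    (fun z hz => by
      rw [wirtingerBar_wirtinger_sub hopen (contDiffOn_wCoord hc') (contDiffOn_wCoord hc) hz,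
        hF.surface.harmonic_w z (hs hz), hF'.surface.harmonic_w z (hs' hz), sub_zero])
    (fun p => by simp [wCoord, hF.eq_curve, hF'.eq_curve])
    (fun p =>
      ((hasDerivAt_snd (hF'.radial_deriv p)).sub
        (hasDerivAt_snd (hF.radial_deriv p))).congr_deriv (sub_self _))
  intro z hz
  refine Prod.ext (sub_eq_zero.1 (h1 hz)) ?_
  exact ofReal_injective (sub_eq_zero.1 (h2 hz))

/-! ### Null vectors and the Gauss map -/

/-- In signature `(+, +, -)` orthogonal null vectors are linearly dependent. The identities express
this without dividing, so zeros of either vector cause no case distinction. -/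
theorem null_pair_identities {u v : LorentzSpace} (hu : IsNull u) (hv : IsNull v)
    (huv : lorentzInner u v = 0) :
    u.1 * v.2 = v.1 * u.2 ∧ u.1 * conj u.1 = (u.2 : ℂ) ^ 2 ∧ v.1 * conj v.1 = (v.2 : ℂ) ^ 2 ∧
      u.1 * conj v.1 = u.2 * v.2 := by
  obtain ⟨c, k⟩ := u
  obtain ⟨l, m⟩ := v
  simp only [IsNull, lorentzInner] at hu hv huv ⊢
  -- The squared modulus of `u₁ v₂ - v₁ u₂`, a combination of the three inner products.
  have hs : (c.re * m - l.re * k) ^ 2 + (c.im * m - l.im * k) ^ 2 = 0 := by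
    linear_combination m ^ 2 * hu + k ^ 2 * hv - 2 * k * m * huv
  have hre : c.re * m - l.re * k = 0 := by nlinarith [sq_nonneg (c.im * m - l.im * k)]
  have him : c.im * m - l.im * k = 0 := by nlinarith [sq_nonneg (c.re * m - l.re * k)]
  have hcross : (c.im * l.re - c.re * l.im) ^ 2 = 0 := by
    linear_combination (l.re ^ 2 + l.im ^ 2) * hu + k ^ 2 * hv -
      (c.re * l.re + c.im * l.im + k * m) * huv
  have hcross' := pow_eq_zero_iff two_ne_zero |>.1 hcross
  refine ⟨?_, ?_, ?_, ?_⟩ <;> apply Complex.ext <;> simp [pow_two] <;> linarith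

theorem IsNull.fst_eq_zero_iff {u : LorentzSpace} (hu : IsNull u) : u.1 = 0 ↔ u.2 = 0 := by
  have h : u.1.re * u.1.re + u.1.im * u.1.im = u.2 * u.2 := by
    simpa [IsNull, lorentzInner, sub_eq_zero] using hu
  constructor <;> intro h0
  · simpa [h0] using h.symm
  · rw [h0, mul_zero] at h
    exact Complex.ext (by simpa using (mul_self_add_mul_self_eq_zero.1 h).1)
      (by simpa using (mul_self_add_mul_self_eq_zero.1 h).2)

variable {γ L : Circle → LorentzSpace}

theorem analyticAt_fst {f : Circle → LorentzSpace} (hf : IsAnalyticOnCircle f) (θ : ℝ) :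
    AnalyticAt ℝ (fun t : ℝ => (f (Circle.exp t)).1) θ :=
  ((ContinuousLinearMap.fst ℝ ℂ ℝ).analyticAt _).comp (hf θ)

theorem analyticAt_snd {f : Circle → LorentzSpace} (hf : IsAnalyticOnCircle f) (θ : ℝ) :
    AnalyticAt ℝ (fun t : ℝ => ((f (Circle.exp t)).2 : ℂ)) θ :=
  (ofRealCLM.analyticAt _).comp (((ContinuousLinearMap.snd ℝ ℂ ℝ).analyticAt _).comp (hf θ))

theorem hasDerivAt_angularDeriv {f : Circle → LorentzSpace} (hf : IsAnalyticOnCircle f) (θ : ℝ) :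
    HasDerivAt (fun t : ℝ => f (Circle.exp t)) (angularDeriv f θ) θ :=
  (hf θ).differentiableAt.hasDerivAt

theorem exists_derivative_extension {f : Circle → ℂ} {f' : ℝ → ℂ}
    (hf : ∀ θ : ℝ, AnalyticAt ℝ (fun t : ℝ => f (Circle.exp t)) θ)
    (hf' : ∀ θ : ℝ, HasDerivAt (fun t : ℝ => f (Circle.exp t)) (f' θ) θ) :
    ∃ R : ℝ, 1 < R ∧ ∃ φ : ℂ → ℂ, DifferentiableOn ℂ φ (annulus R⁻¹ R) ∧
      ∀ θ : ℝ, φ (Circle.exp θ) = f' θ := by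
  obtain ⟨R, hR, φ, hφ, hφf⟩ := exists_extension_annulus hf
  have hopen := isOpen_annulus R⁻¹ R
  refine ⟨R, hR, fun z => I * (deriv φ z * z),
    (differentiableOn_const I).mul ((hφ.deriv hopen).mul differentiableOn_id), fun θ => ?_⟩
  have h := hasDerivAt_comp_circleExp (hφ.differentiableAt (hopen.mem_nhds
    (circle_mem_annulus (inv_lt_one_of_one_lt₀ hR) hR (Circle.exp θ))))
  simp only [hφf] at h
  exact h.unique (hf' θ)

/-- The quotient of two holomorphic functions that have the same modulus on the unit circle
extends analytically across the circle. -/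
theorem exists_unimodular_quotient {R : ℝ} (hR : 1 < R) {P W : ℂ → ℂ}
    (hP : DifferentiableOn ℂ P (annulus R⁻¹ R)) (hW : DifferentiableOn ℂ W (annulus R⁻¹ R))
    (hnorm : ∀ p : Circle, ‖P p‖ = ‖W p‖) (hW0 : ∃ p : Circle, W p ≠ 0) :
    ∃ g : ℂ → ℂ, ∀ p : Circle, AnalyticAt ℂ g p ∧ g p * W p = P p := by
  have hR0 : 0 < R⁻¹ := by positivity
  have hR1 : R⁻¹ < 1 := inv_lt_one_of_one_lt₀ hR
  have hopen := isOpen_annulus R⁻¹ R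
  have hPa := hP.analyticOnNhd hopen
  have hWa := hW.analyticOnNhd hopen
  set Q : ℂ → ℂ := fun z => P z / W z with hQ
  have hQm : MeromorphicOn Q (annulus R⁻¹ R) := fun z hz =>
    (hPa z hz).meromorphicAt.div (hWa z hz).meromorphicAt
  refine ⟨toMeromorphicNFOn Q (annulus R⁻¹ R), fun p => ?_⟩
  have hp := circle_mem_annulus hR1 hR p
  have hne : ∀ᶠ q in 𝓝[≠] (p : ℂ), W q ≠ 0 := by
    refine (hWa p hp).eventually_eq_zero_or_eventually_ne_zero.resolve_left fun h => ?_
    obtain ⟨p₁, hp₁⟩ := hW0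
    exact hp₁ (eqOn_annulus hR0 hR1 hR hW (differentiableOn_const 0) p (h.mono fun _ h _ => h)
      (circle_mem_annulus hR1 hR p₁))
  -- At a pole `|Q|` would tend to infinity, while `|Q| = 1` at circle points arbitrarily near `p`.
  have hord : 0 ≤ meromorphicOrderAt Q p := by
    by_contra! hneg
    have h1 := (tendsto_norm_cobounded_atTop.comp
      ((tendsto_cobounded_iff_meromorphicOrderAt_neg (hQm p hp)).2 hneg)).eventually_gt_atTop 1
    have h2 : ∃ᶠ q in 𝓝[≠] (p : ℂ), ‖Q q‖ = 1 := frequently_nhdsNE_circle <| by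
      filter_upwards [hne] with q hq hq1
      obtain ⟨q, rfl⟩ := exists_circle_eq hq1
      rw [hQ, norm_div, hnorm, div_self (norm_ne_zero_iff.2 hq)]
    obtain ⟨q, hq1, hq2⟩ := (h2.and_eventually h1).exists
    exact hq2.ne' hq1
  have han : AnalyticAt ℂ (toMeromorphicNFOn Q (annulus R⁻¹ R)) p := by
    rw [← (meromorphicNFOn_toMeromorphicNFOn Q _ hp).meromorphicOrderAt_nonneg_iff_analyticAt,
      meromorphicOrderAt_toMeromorphicNFOn hQm hp]
    exact hord
  refine ⟨han, ?_⟩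
  have heq : (fun z => toMeromorphicNFOn Q (annulus R⁻¹ R) z * W z) =ᶠ[𝓝[≠] (p : ℂ)] P := by
    filter_upwards [hne, hQm.toMeromorphicNFOn_eq_self_on_nhdsNE hp] with q hq1 hq2
    rw [hq2, hQ, div_mul_cancel₀ _ hq1]
  exact ((ContinuousAt.eventuallyEq_nhds_iff_eventuallyEq_nhdsNE
    (han.mul (hWa p hp)).continuousAt (hPa p hp).continuousAt).1 heq).eq_of_nhds

/-- No branch of a square root is chosen. For a null vector `(c, k)` with `k ≠ 0` the quotient `c /
k` is a square root of `c / conj c`, and parallel vectors share this quotient. Combining `γ' + i L`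
keeps the denominator nonzero wherever either vector is nonzero. -/
theorem exists_isGaussExtension (hdata : IsSingularBjorlingData γ L) :
    ∃ (r R : ℝ) (G : ℂ → ℂ), IsGaussExtension γ L r R G := by
  obtain ⟨R₁, hR₁, C, hC, hCf⟩ := exists_derivative_extension
    (f := fun p => (γ p).1) (f' := fun θ => (angularDeriv γ θ).1)
    (analyticAt_fst hdata.analytic_curve) fun θ => hasDerivAt_fst (hasDerivAt_angularDeriv hdata.analytic_curve θ)
  obtain ⟨R₂, hR₂, K, hK, hKf⟩ := exists_derivative_extension
    (f := fun p => ((γ p).2 : ℂ)) (f' := fun θ => ((angularDeriv γ θ).2 : ℂ))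
    (analyticAt_snd hdata.analytic_curve) fun θ => hasDerivAt_snd (hasDerivAt_angularDeriv hdata.analytic_curve θ)
  obtain ⟨R₃, hR₃, l, hl, hlf⟩ := exists_extension_annulus (f := fun p => (L p).1)
    (analyticAt_fst hdata.analytic_field)
  obtain ⟨R₄, hR₄, m, hm, hmf⟩ := exists_extension_annulus (f := fun p => ((L p).2 : ℂ))
    (analyticAt_snd hdata.analytic_field)
  have hR : 1 < min (min R₁ R₂) (min R₃ R₄) := lt_min (lt_min hR₁ hR₂) (lt_min hR₃ hR₄)
  set R := min (min R₁ R₂) (min R₃ R₄)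
  replace hC := hC.mono (annulus_inv_mono hR ((min_le_left _ _).trans (min_le_left _ _)))
  replace hK := hK.mono (annulus_inv_mono hR ((min_le_left _ _).trans (min_le_right _ _)))
  replace hl := hl.mono (annulus_inv_mono hR ((min_le_right _ _).trans (min_le_left _ _)))
  replace hm := hm.mono (annulus_inv_mono hR ((min_le_right _ _).trans (min_le_right _ _)))
  have hid := fun θ : ℝ => null_pair_identities (hdata.null_curve θ)
    (hdata.null_field (Circle.exp θ)) (hdata.orthogonal θ)
  have hWne : ∀ a b : ℝ, (a ≠ 0 ∨ b ≠ 0) → (a : ℂ) + I * b ≠ 0 := fun a b hab h => by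
    have h1 := congrArg Complex.re h
    have h2 := congrArg Complex.im h
    simp at h1 h2
    tauto
  obtain ⟨g, hg⟩ := exists_unimodular_quotient hR (P := fun z => C z + I * l z)
    (W := fun z => K z + I * m z) (hC.add (hl.const_mul I)) (hK.add (hm.const_mul I))
    (fun p => by
      obtain ⟨θ, rfl⟩ := Circle.exp_surjective p
      obtain ⟨-, h2, h3, h4⟩ := hid θ
      have h5 := congrArg conj h4
      simp only [map_mul, conj_conj, conj_ofReal] at h5
      refine (sq_eq_sq₀ (norm_nonneg _) (norm_nonneg _)).1 ?_
      apply ofReal_injective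
      simp only [ofReal_pow, ← mul_conj', hCf, hKf, hlf, hmf, map_add, map_mul, conj_I,
        conj_ofReal]
      linear_combination h2 - I ^ 2 * h3 - I * h4 + I * h5)
    (by
      rcases hdata.nontrivial with ⟨θ, hθ⟩ | ⟨p, hp⟩
      · refine ⟨Circle.exp θ, ?_⟩
        simp only [hKf, hmf]
        refine hWne _ _ (Or.inl fun h => hθ ?_)
        exact Prod.ext ((IsNull.fst_eq_zero_iff (hdata.null_curve θ)).2 h) h
      · obtain ⟨θ, rfl⟩ := Circle.exp_surjective p
        refine ⟨Circle.exp θ, ?_⟩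
        simp only [hKf, hmf]
        refine hWne _ _ (Or.inr fun h => hp ?_)
        exact Prod.ext ((IsNull.fst_eq_zero_iff (hdata.null_field _)).2 h) h)
  have hloc : HasLocalExtension fun p : Circle => g p := fun p =>
    ⟨g, (hg p).1, Eventually.of_forall fun _ _ h => congrArg g h.symm⟩
  obtain ⟨δ, hδ, hδ1, G, hG, hGg⟩ := hloc.exists_extension
  have hGW : ∀ θ : ℝ, G (Circle.exp θ) * ((angularDeriv γ θ).2 + I * (L (Circle.exp θ)).2) =
      (angularDeriv γ θ).1 + I * (L (Circle.exp θ)).1 := fun θ => by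
    simpa only [hGg, hCf, hKf, hlf, hmf] using (hg (Circle.exp θ)).2
  refine ⟨1 - δ, 1 + δ, G, by linarith, by linarith, by linarith, hG, fun θ h => ?_, fun θ h => ?_⟩
  · obtain ⟨h1, -, h3, -⟩ := hid θ
    have h0 := (IsNull.fst_eq_zero_iff (hdata.null_field (Circle.exp θ))).not.1 h
    -- By parallelism the numerator times `L₃` is `L₁ + iL₂` times the denominator, which cancels.
    have h5 : G (Circle.exp θ) * (L (Circle.exp θ)).2 = (L (Circle.exp θ)).1 := by
      refine mul_right_cancel₀ (hWne (angularDeriv γ θ).2 _ (Or.inr h0)) ?_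
      linear_combination (L (Circle.exp θ)).2 * hGW θ + h1
    rw [eq_div_iff ((map_ne_zero _).2 h)]
    refine mul_right_cancel₀ h ?_
    linear_combination G (Circle.exp θ) ^ 2 * h3 +
      (G (Circle.exp θ) * (L (Circle.exp θ)).2 + (L (Circle.exp θ)).1) * h5
  · obtain ⟨h1, h2, -, -⟩ := hid θ
    have h0 := (IsNull.fst_eq_zero_iff (hdata.null_curve θ)).not.1 h
    have h5 : G (Circle.exp θ) * (angularDeriv γ θ).2 = (angularDeriv γ θ).1 := by
      refine mul_right_cancel₀ (hWne (angularDeriv γ θ).2 (L (Circle.exp θ)).2 (Or.inl h0)) ?_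
      linear_combination (angularDeriv γ θ).2 * hGW θ - I * h1
    rw [eq_div_iff ((map_ne_zero _).2 h)]
    refine mul_right_cancel₀ h ?_
    linear_combination G (Circle.exp θ) ^ 2 * h2 +
      (G (Circle.exp θ) * (angularDeriv γ θ).2 + (angularDeriv γ θ).1) * h5

/-! ### Existence of the surface -/

/-- The Cauchy problem is solved among complex-valued functions. For the height coordinate, whose
data are real, passing to the real part keeps the data. -/
theorem hasFDerivAt_re_wirtinger {w : ℂ → ℂ} {a b z : ℂ}
    (hw : HasFDerivAt w (wirtingerCLM a b) z) :
    HasFDerivAt (fun z => ((w z).re : ℂ)) (wirtingerCLM ((a + b) / 2) ((a + b) / 2)) z := by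
  have h := ((hw.add (HasFDerivAt.conj_wirtinger hw)).const_mul (1 / 2 : ℂ))
  refine (h.congr_of_eventuallyEq (Eventually.of_forall fun z => ?_)).congr_fderiv
    (ContinuousLinearMap.ext fun v => ?_)
  · simp only [re_eq_add_conj, Pi.add_apply]
    ring
  · simp only [_root_.add_apply, _root_.smul_apply, wirtingerCLM_apply, smul_eq_mul, map_mul,
      map_div₀, map_add, conj_ofNat]
    ring

theorem wirtingerBar_wirtinger_eq_zero {h a b : ℂ → ℂ} {U : Set ℂ} (hU : IsOpen U)
    (ha : DifferentiableOn ℂ a U) (hh : ∀ z ∈ U, HasFDerivAt h (wirtingerCLM (a z) (b z)) z)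
    {z : ℂ} (hz : z ∈ U) : wirtingerBar (wirtinger h) z = 0 := by
  have heq : wirtinger h =ᶠ[𝓝 z] a := by
    filter_upwards [hU.mem_nhds hz] with w hw using wirtinger_eq (hh w hw)
  rw [wirtingerBar, heq.fderiv_eq]
  exact wirtingerBar_of_hasDerivAt (ha.hasDerivAt (hU.mem_nhds hz))

/-- The Cauchy data on the unit circle determine the Wirtinger derivatives there. -/
theorem wirtinger_mul_circle {h : ℂ → ℂ} {a b f' l : ℂ} {θ : ℝ}
    (hh : HasFDerivAt h (wirtingerCLM a b) (Circle.exp θ))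
    (hf : HasDerivAt (fun t : ℝ => h (Circle.exp t)) f' θ)
    (hl : a * Circle.exp θ + conj (b * Circle.exp θ) = l) :
    a * Circle.exp θ = (l - I * f') / 2 ∧ b * Circle.exp θ = (conj l - I * conj f') / 2 := by
  have h1 := (hasDerivAt_tangential hh).unique hf
  have h2 : conj (b * Circle.exp θ) = (l + I * f') / 2 := by
    linear_combination hl / 2 + I / 2 * h1 -
      (a * Circle.exp θ - conj (b * Circle.exp θ)) / 2 * I_mul_I
  refine ⟨by linear_combination hl - h2, ?_⟩
  have h3 := congrArg conj h2
  rw [conj_conj] at h3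
  rw [h3]
  simp only [map_div₀, map_add, map_mul, conj_I, conj_ofNat]
  ring

theorem exists_norm_ne {R : ℝ} (hR : 1 < R) (hdata : IsSingularBjorlingData γ L) {a b : ℂ → ℂ}
    (ha : DifferentiableOn ℂ a (annulus R⁻¹ R)) (hb : DifferentiableOn ℂ b (annulus R⁻¹ R))
    (hab : ∀ θ : ℝ, a (Circle.exp θ) * Circle.exp θ =
        ((L (Circle.exp θ)).1 - I * (angularDeriv γ θ).1) / 2 ∧
      b (Circle.exp θ) * Circle.exp θ =
        (conj (L (Circle.exp θ)).1 - I * conj (angularDeriv γ θ).1) / 2)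
    {r₀ R₀ : ℝ} {G : ℂ → ℂ} (hG : IsGaussExtension γ L r₀ R₀ G)
    (hG1 : ∃ z ∈ annulus r₀ R₀, ‖G z‖ ≠ 1) : ∃ z ∈ annulus R⁻¹ R, ‖a z‖ ≠ ‖b z‖ := by
  by_contra! H
  have hopen := isOpen_annulus R⁻¹ R
  have hpC : ∀ p : Circle, (p : ℂ) ∈ annulus R⁻¹ R :=
    circle_mem_annulus (inv_lt_one_of_one_lt₀ hR) hR
  -- If `a`, hence also `b`, vanished on the whole circle, so would both `γ'` and `L`.
  obtain ⟨p, hp⟩ : ∃ p : Circle, a p ≠ 0 := by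
    by_contra! h0
    have hzero : ∀ θ : ℝ, (L (Circle.exp θ)).1 = 0 ∧ (angularDeriv γ θ).1 = 0 := fun θ => by
      obtain ⟨h1, h2⟩ := hab θ
      have hb0 : b (Circle.exp θ) = 0 := by
        rw [← norm_eq_zero, ← H _ (hpC _), h0, norm_zero]
      rw [h0, zero_mul] at h1
      rw [hb0, zero_mul] at h2
      have h3 := congrArg conj h2
      simp only [map_div₀, map_sub, map_mul, conj_conj, conj_I, map_zero, conj_ofNat] at h3
      have hl : (L (Circle.exp θ)).1 = 0 := by linear_combination -h1 - h3
      refine ⟨hl, mul_left_cancel₀ I_ne_zero ?_⟩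
      linear_combination h1 - h3
    rcases hdata.nontrivial with ⟨θ, hθ⟩ | ⟨p, hp⟩
    · have h := (hzero θ).2
      exact hθ (Prod.ext h ((IsNull.fst_eq_zero_iff (hdata.null_curve θ)).1 h))
    · obtain ⟨θ, rfl⟩ := Circle.exp_surjective p
      have h := (hzero θ).1
      exact hp (Prod.ext h ((IsNull.fst_eq_zero_iff (hdata.null_field _)).1 h))
  have hne : ∀ᶠ z in 𝓝 (p : ℂ), a z ≠ 0 :=
    (ha.continuousOn.continuousAt (hopen.mem_nhds (hpC p))).eventually_ne hp
  have hmem : ∀ᶠ z in 𝓝 (p : ℂ), z ∈ annulus R⁻¹ R := hopen.mem_nhds (hpC p)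
  have hnorm : ∀ z ∈ annulus R⁻¹ R, a z ≠ 0 → ‖b z / a z‖ = 1 := fun z hz h => by
    rw [norm_div, ← H z hz, div_self (norm_ne_zero_iff.2 h)]
  -- The maximum principle: a holomorphic function of constant modulus is constant.
  have hconst : ∀ᶠ z in 𝓝 (p : ℂ), b z / a z = b p / a p := by
    refine Complex.eventually_eq_of_isLocalMax_norm (f := fun z => b z / a z) ?_ ?_
    · filter_upwards [hne, hmem] with z hz hz'
      exact (hb.differentiableAt (hopen.mem_nhds hz')).div
        (ha.differentiableAt (hopen.mem_nhds hz')) hz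
    · filter_upwards [hne, hmem] with z hz hz'
      simp only [Function.comp]
      rw [hnorm z hz' hz, hnorm p (hpC p) hp]
  -- Since `c * conj l` is real, `l - i c` and its counterpart in `conj l` and `conj c` have
  -- quotient `l / conj l` or `c / conj c`; where both `l` and `c` vanish, both sides are `0`.
  have hGab : ∀ q : Circle, G q ^ 2 * b q = a q := fun q => by
    obtain ⟨θ, rfl⟩ := Circle.exp_surjective q
    obtain ⟨h1, h2⟩ := hab θ
    obtain ⟨-, -, -, h4⟩ := null_pair_identities (hdata.null_curve θ)
      (hdata.null_field (Circle.exp θ)) (hdata.orthogonal θ)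
    have h5 := congrArg conj h4
    simp only [map_mul, conj_conj, conj_ofReal] at h5
    refine mul_right_cancel₀ (Circle.coe_ne_zero (Circle.exp θ)) ?_
    rw [mul_assoc, h2, h1]
    by_cases hl : (L (Circle.exp θ)).1 = 0
    · by_cases hc : (angularDeriv γ θ).1 = 0
      · simp [hl, hc]
      · have h6 := hG.sq_curve θ hc
        rw [eq_div_iff ((map_ne_zero _).2 hc)] at h6
        rw [hl, map_zero]
        linear_combination -I / 2 * h6
    · have h6 := hG.sq_field θ hl
      rw [h6, div_mul_eq_mul_div, div_eq_iff ((map_ne_zero _).2 hl)]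
      linear_combination I / 2 * h4 - I / 2 * h5
  have hGκ : Set.EqOn (fun z => G z ^ 2 * (b p / a p)) (fun _ => 1) (annulus r₀ R₀) := by
    refine eqOn_annulus hG.pos hG.lt_one hG.one_lt ((hG.holomorphic.pow 2).mul_const _)
      (differentiableOn_const 1) p ?_
    filter_upwards [hne, hconst] with q hq1 hq2 hq
    obtain ⟨q, rfl⟩ := exists_circle_eq hq
    rw [← hq2, ← mul_div_assoc, hGab, div_self hq1]
  obtain ⟨z, hz, hz1⟩ := hG1
  have h7 := congrArg norm (hGκ hz)
  simp only [norm_mul, norm_pow, hnorm p (hpC p) hp, mul_one, norm_one] at h7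
  exact hz1 ((pow_eq_one_iff_of_nonneg (norm_nonneg _) two_ne_zero).1 h7)

theorem exists_solution (hdata : IsSingularBjorlingData γ L) {r₀ R₀ : ℝ} {G : ℂ → ℂ}
    (hG : IsGaussExtension γ L r₀ R₀ G) (hG1 : ∃ z ∈ annulus r₀ R₀, ‖G z‖ ≠ 1) :
    ∃ (r R : ℝ) (F : ℂ → LorentzSpace), SolvesSingularBjorling γ L r R F ∧
      Metric.sphere (0 : ℂ) 1 ⊆ singularSet F (annulus r R) := by
  obtain ⟨R₁, hR₁, h, a, b, ha, hb, hh, hhγ, hhL⟩ := exists_harmonic_extension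
    (f := fun p => (γ p).1) (l := fun p => (L p).1) (analyticAt_fst hdata.analytic_curve)
    (analyticAt_fst hdata.analytic_field)
  obtain ⟨R₂, hR₂, w, c, d, hc, hd, hw, hwγ, hwL⟩ := exists_harmonic_extension
    (f := fun p => ((γ p).2 : ℂ)) (l := fun p => ((L p).2 : ℂ))
    (analyticAt_snd hdata.analytic_curve) (analyticAt_snd hdata.analytic_field)
  have hR : 1 < min R₁ R₂ := lt_min hR₁ hR₂
  have hs₁ := annulus_inv_mono hR (min_le_left R₁ R₂)
  have hs₂ := annulus_inv_mono hR (min_le_right R₁ R₂)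
  set R := min R₁ R₂
  replace ha := ha.mono hs₁
  replace hb := hb.mono hs₁
  replace hc := hc.mono hs₂
  replace hd := hd.mono hs₂
  replace hh : ∀ z ∈ annulus R⁻¹ R, _ := fun z hz => hh z (hs₁ hz)
  replace hw : ∀ z ∈ annulus R⁻¹ R, _ := fun z hz => hw z (hs₂ hz)
  have hR0 : 0 < R⁻¹ := by positivity
  have hR1 : R⁻¹ < 1 := inv_lt_one_of_one_lt₀ hR
  have hopen := isOpen_annulus R⁻¹ R
  have hpC : ∀ p : Circle, (p : ℂ) ∈ annulus R⁻¹ R := circle_mem_annulus hR1 hR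
  set s : ℂ → ℂ := fun z => (c z + d z) / 2 with hsdef
  have hs : DifferentiableOn ℂ s (annulus R⁻¹ R) := (hc.add hd).div_const 2
  set F : ℂ → LorentzSpace := fun z => (h z, (w z).re) with hF
  have hFh : ∀ z ∈ annulus R⁻¹ R, HasFDerivAt (hCoord F) (wirtingerCLM (a z) (b z)) z := hh
  have hFw : ∀ z ∈ annulus R⁻¹ R, HasFDerivAt (wCoord F) (wirtingerCLM (s z) (s z)) z :=
    fun z hz => hasFDerivAt_re_wirtinger (hw z hz)
  have hab : ∀ θ : ℝ, a (Circle.exp θ) * Circle.exp θ =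
        ((L (Circle.exp θ)).1 - I * (angularDeriv γ θ).1) / 2 ∧
      b (Circle.exp θ) * Circle.exp θ =
        (conj (L (Circle.exp θ)).1 - I * conj (angularDeriv γ θ).1) / 2 := fun θ => by
    refine wirtinger_mul_circle (hh _ (hpC _)) ?_ (hhL _)
    simpa only [hhγ] using hasDerivAt_fst (hasDerivAt_angularDeriv hdata.analytic_curve θ)
  have hsc : ∀ θ : ℝ, s (Circle.exp θ) * Circle.exp θ =
        ((L (Circle.exp θ)).2 - I * (angularDeriv γ θ).2) / 2 := fun θ => by
    obtain ⟨h1, h2⟩ := wirtinger_mul_circle (f' := (angularDeriv γ θ).2) (hw _ (hpC _))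
      (by simpa only [hwγ] using hasDerivAt_snd (hasDerivAt_angularDeriv hdata.analytic_curve θ))
      (hwL (Circle.exp θ))
    simp only [conj_ofReal] at h2
    simp only [hsdef]
    linear_combination (h1 + h2) / 2
  have hid := fun θ : ℝ => null_pair_identities (hdata.null_curve θ)
    (hdata.null_field (Circle.exp θ)) (hdata.orthogonal θ)
  have hid' : ∀ θ : ℝ, (L (Circle.exp θ)).1 * conj (angularDeriv γ θ).1 =
      (angularDeriv γ θ).2 * (L (Circle.exp θ)).2 := fun θ => by
    have h5 := congrArg conj (hid θ).2.2.2
    simp only [map_mul, conj_conj, conj_ofReal] at h5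
    rw [mul_comm, h5]
  -- On the circle `4 z² (a b - s²)` is `⟨L, L⟩ - ⟨γ', γ'⟩ - 2i⟨γ', L⟩`.
  have hconf : Set.EqOn (fun z => a z * b z - s z ^ 2) (fun _ => 0) (annulus R⁻¹ R) := by
    refine eqOn_annulus_of_eq_circle hR0 hR1 hR ((ha.mul hb).sub (hs.pow 2))
      (differentiableOn_const 0) fun p => ?_
    obtain ⟨θ, rfl⟩ := Circle.exp_surjective p
    obtain ⟨h1, h2⟩ := hab θ
    obtain ⟨-, h3, h4, h5⟩ := hid θ
    refine mul_right_cancel₀ (pow_ne_zero 2 (Circle.coe_ne_zero (Circle.exp θ))) ?_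
    calc _ = (a (Circle.exp θ) * Circle.exp θ) * (b (Circle.exp θ) * Circle.exp θ) -
          (s (Circle.exp θ) * Circle.exp θ) ^ 2 := by ring
      _ = _ := by
        rw [h1, h2, hsc θ]
        linear_combination h4 / 4 + I ^ 2 / 4 * h3 - I / 4 * h5 - I / 4 * hid' θ
  -- The two squared moduli differ by a multiple of the imaginary part of `l * conj c`, which is
  -- zero.
  have hsing : ∀ p : Circle, ‖a p‖ = ‖b p‖ := fun p => by
    obtain ⟨θ, rfl⟩ := Circle.exp_surjective p
    obtain ⟨h1, h2⟩ := hab θ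
    obtain ⟨-, -, -, h5⟩ := hid θ
    suffices ‖a (Circle.exp θ) * Circle.exp θ‖ = ‖b (Circle.exp θ) * Circle.exp θ‖ by
      simpa only [norm_mul, Circle.norm_coe, mul_one] using this
    rw [h1, h2]
    refine (sq_eq_sq₀ (norm_nonneg _) (norm_nonneg _)).1 (ofReal_injective ?_)
    simp only [ofReal_pow, ← mul_conj', map_div₀, map_sub, map_mul, conj_conj, conj_I, conj_ofNat]
    linear_combination I / 2 * hid' θ - I / 2 * h5
  obtain ⟨z₁, hz₁, hz₁'⟩ := exists_norm_ne hR hdata ha hb hab hG hG1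
  refine ⟨R⁻¹, R, F, ⟨hR0, hR1, hR, ⟨hopen, ⟨⟨_, hpC 1⟩, isPreconnected_annulus hR0 (by linarith)⟩,
    ?_, ?_, ?_, ?_, z₁, hz₁, ?_⟩, fun p => ?_, fun p => ?_⟩, fun z hz => ?_⟩
  · exact (contDiffOn_of_wirtinger hopen ha hb hh).prodMk
      (reCLM.contDiff.comp_contDiffOn (contDiffOn_of_wirtinger hopen hc hd hw))
  · exact fun z hz => wirtingerBar_wirtinger_eq_zero hopen ha hFh hz
  · exact fun z hz => wirtingerBar_wirtinger_eq_zero hopen hs hFw hz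
  · intro z hz
    rw [wirtinger_eq (hFh z hz), wirtingerBar_eq (hFh z hz), wirtinger_eq (hFw z hz), conj_conj]
    exact hconf hz
  · rwa [wirtinger_eq (hFh z₁ hz₁), wirtingerBar_eq (hFh z₁ hz₁), norm_conj]
  · simp only [hF, hhγ, hwγ, ofReal_re]
  · have h1 := hasDerivAt_radial (hh p (hpC p))
    have h2 := hasDerivAt_radial (hw p (hpC p))
    rw [hhL] at h1
    rw [hwL] at h2
    exact h1.prodMk (reCLM.hasFDerivAt.comp_hasDerivAt (1 : ℝ) h2)
  · obtain ⟨p, rfl⟩ := exists_circle_eq (mem_sphere_zero_iff_norm.1 hz)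
    refine ⟨hpC p, ?_⟩
    rw [wirtinger_eq (hFh p (hpC p)), wirtingerBar_eq (hFh p (hpC p)), norm_conj]
    exact hsing p

end SingularBjorling

theorem mainTheorem1 (γ L : Circle → LorentzSpace) (hdata : IsSingularBjorlingData γ L) :
    (∃ (r R : ℝ) (G : ℂ → ℂ), IsGaussExtension γ L r R G) ∧
    ∀ (r₀ R₀ : ℝ) (G : ℂ → ℂ), IsGaussExtension γ L r₀ R₀ G →
      (∃ z ∈ annulus r₀ R₀, ‖G z‖ ≠ 1) →
      ∃ (r R : ℝ) (F : ℂ → LorentzSpace),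
        SolvesSingularBjorling γ L r R F ∧
        Metric.sphere (0 : ℂ) 1 ⊆ singularSet F (annulus r R) ∧
        ∀ (r' R' : ℝ) (F' : ℂ → LorentzSpace), SolvesSingularBjorling γ L r' R' F' →
          Set.EqOn F' F (annulus r R ∩ annulus r' R') := by
  refine ⟨SingularBjorling.exists_isGaussExtension hdata, fun r₀ R₀ G hG hG1 => ?_⟩
  obtain ⟨r, R, F, hF, hsing⟩ := SingularBjorling.exists_solution hdata hG hG1
  exact ⟨r, R, F, hF, hsing, fun r' R' F' hF' =>
    SingularBjorling.eqOn_of_solvesSingularBjorling hF hF'⟩
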